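/- Let $d\ge 1$, put $D=\binom{d+1}{2}$, let $G=(V,E)$ be a finite graph (parallel edges and loops allowed), let $\mathcal R$ be a finite multiset of vertices of $G$, and let ${\bm b}^\circ:\mathcal R\to Gr(2,\mathbb R^{d+1})$, $r\mapsto[{\bm b}^\circ_r]$, where the Grassmannian $Gr(2,\mathbb R^{d+1})$ of $2$-dimensional subspaces of $\mathbb R^{d+1}$ is regarded as a subset of $\mathbb P(\bigwedge^2\mathbb R^{d+1})$ by the Plücker embedding. For $X\subseteq V$ let $\mathcal R_X$ be the multiset of the $r\in\mathcal R$ that lie in $X$, and write $\mathcal R_v=\mathcal R_{\{v\}}$. For a bar-configuration ${\bm b}:E\to Gr(2,\mathbb R^{d+1})$, $e\mapsto[{\bm b}_e]$, an infinitesimal motion of the body-bar framework with bar-boundary $(G,\mathcal R;{\bm b},{\bm b}^\circ)$ is a map ${\bm m}:V\to\bigwedge^{d-1}\mathbb R^{d+1}$ with $$\langle {\bm m}(u)-{\bm m}(v),\ast{\bm b}_e\rangle=0\quad\text{for all } e=uv\in E,\qquad \langle {\bm m}(v),\ast{\bm b}^\circ_r\rangle=0\quad\text{for all } v\in V,\ r\in\mathcal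 R_v,$$ where $\langle\cdot,\cdot\rangle$ is the standard inner product and $\ast$ is the Hodge star. The framework is infinitesimally rigid if its only infinitesimal motion is ${\bm m}=0$. Then there exists a bar-configuration ${\bm b}:E\to Gr(2,\mathbb R^{d+1})$ such that $(G,\mathcal R;{\bm b},{\bm b}^\circ)$ is infinitesimally rigid if and only if $$|\delta_G(\mathcal P)|\ \ge\ D|\mathcal P|-\sum_{X\in\mathcal P}\dim\operatorname{span}\{{\bm b}^\circ_r\mid r\in\mathcal R_X\}$$ for every partition $\mathcal P$ of $V$ into non-empty subsets, where $\delta_G(\mathcal P)$ is the set of edges of $G$ that connect two distinct members of $\mathcal P$. -/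

import Mathlib

open scoped LinearAlgebra.Projectivization

noncomputable section

namespace BodyBar

/-- The real vector space `⋀^k ℝ^n`. -/
abbrev ExtPow (n k : ℕ) : Type := ↥(⋀[ℝ]^k (Fin n → ℝ))

/-- The standard basis of `⋀^k ℝ^n`: the vectors `e_{i₁} ∧ ⋯ ∧ e_{i_k}` for `i₁ < ⋯ < i_k`,
indexed by the `k`-element subsets `{i₁, …, i_k}` of `Fin n`. -/
def stdBasis (n k : ℕ) : Module.Basis (Set.powersetCard (Fin n) k) ℝ (ExtPow n k) :=
  (Pi.basisFun ℝ (Fin n)).exteriorPower k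

/-- The standard Euclidean inner product on `⋀^k ℝ^n`, for which `stdBasis` is orthonormal. -/
def innerProd {n k : ℕ} (a b : ExtPow n k) : ℝ :=
  ∑ I : Set.powersetCard (Fin n) k, (stdBasis n k).repr a I * (stdBasis n k).repr b I

/-- The sign `ε` with `e_I ∧ e_{Iᶜ} = ε • (e_1 ∧ ⋯ ∧ e_n)`, that is, `-1` to the number of
inversions of the sequence listing `I` increasingly and then `Iᶜ` increasingly. -/
def shuffleSign {n : ℕ} (I : Finset (Fin n)) : ℝ :=
  (-1) ^ ((I ×ˢ Iᶜ).filter fun p => p.2 < p.1).card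

/-- The Hodge star `⋀^k ℝ^n → ⋀^l ℝ^n` with `k + l = n`, the linear map determined by
`∗ e_I = ε • e_{Iᶜ}`, where `ε` is the sign with `e_I ∧ e_{Iᶜ} = ε • (e_1 ∧ ⋯ ∧ e_n)`. -/
def hodgeStar {n k l : ℕ} (h : k + l = n) : ExtPow n k →ₗ[ℝ] ExtPow n l :=
  (stdBasis n k).constr ℝ fun I =>
    shuffleSign (I : Finset (Fin n)) •
      stdBasis n l (Set.powersetCard.compl (by simpa [add_comm] using h) I)

/-- For `a ∈ ⋀^l ℝ^n` and `b ∈ ⋀^k ℝ^n` with `k + l = n`, the number `⟨a, ∗ b⟩`. -/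
def pairing {n k l : ℕ} (h : k + l = n) (a : ExtPow n l) (b : ExtPow n k) : ℝ :=
  innerProd a (hodgeStar h b)

/-- The Grassmannian `Gr(k, ℝ^n)` as a subset of `ℙ(⋀^k ℝ^n)` by the Plücker embedding: the
classes `[v₁ ∧ ⋯ ∧ v_k]`, where `v₁, …, v_k` is a basis of a `k`-dimensional subspace. -/
def Gr (k n : ℕ) : Set (ℙ ℝ (ExtPow n k)) :=
  {x | ∃ v : Fin k → Fin n → ℝ, LinearIndependent ℝ v ∧
    ∃ h : exteriorPower.ιMulti ℝ k v ≠ 0,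
      x = Projectivization.mk ℝ (exteriorPower.ιMulti ℝ k v) h}

/-- Homogeneous coordinates (Plücker coordinates) of a point of the Grassmannian. They are
determined up to a nonzero factor, on which nothing below depends. -/
def coords {k n : ℕ} (x : Gr k n) : ExtPow n k := x.1.rep

variable {α β R : Type*}

/-- Infinitesimal motions of the `d`-dimensional body-bar framework with bar-boundary
`(G, R; b, b₀)`. The multigraph `G` has a body for each vertex and a bar for each edge; the
multiset of roots is the family `root : R → V(G)`, and `b₀ r` is the bar linking the body
`root r` to the fixed environment. -/
def IsInfinitesimalMotion {d : ℕ} (hd : 1 ≤ d) (G : Graph α β) (root : R → G.vertexSet)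
    (b : G.edgeSet → Gr 2 (d + 1)) (b₀ : R → Gr 2 (d + 1))
    (m : G.vertexSet → ExtPow (d + 1) (d - 1)) : Prop :=
  (∀ (e : G.edgeSet) (u v : G.vertexSet), G.IsLink e u v →
    pairing (by omega : 2 + (d - 1) = d + 1) (m u - m v) (coords (b e)) = 0) ∧
  ∀ r : R, pairing (by omega : 2 + (d - 1) = d + 1) (m (root r)) (coords (b₀ r)) = 0

/-- A body-bar framework with bar-boundary is infinitesimally rigid if it has no nonzero
infinitesimal motion. -/
def IsInfinitesimallyRigid {d : ℕ} (hd : 1 ≤ d) (G : Graph α β) (root : R → G.vertexSet)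
    (b : G.edgeSet → Gr 2 (d + 1)) (b₀ : R → Gr 2 (d + 1)) : Prop :=
  ∀ m : G.vertexSet → ExtPow (d + 1) (d - 1),
    IsInfinitesimalMotion hd G root b b₀ m → m = 0

/-- `δ_G(P)`: the edges of `G` connecting two distinct parts of the partition `P` of `V(G)`. -/
def crossingEdges (G : Graph α β) (P : Finpartition G.vertexSet) : Set β :=
  {e | ∃ X ∈ P.parts, ∃ Y ∈ P.parts, X ≠ Y ∧ ∃ x ∈ X, ∃ y ∈ Y, G.IsLink e x y}

/-- The dimension of the span of the boundary bars `b₀ r` with `r ∈ R_X`, that is, with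
`root r ∈ X`. -/
def boundaryDim {d : ℕ} (G : Graph α β) (root : R → G.vertexSet) (b₀ : R → Gr 2 (d + 1))
    (X : Set α) : ℕ :=
  Module.finrank ℝ
    (Submodule.span ℝ ((fun r => coords (b₀ r)) '' {r : R | (root r : α) ∈ X}))

end BodyBar

end

/-! Put `W = ⋀² ℝ^(d+1)`, of dimension `D`. The pairing `⟨a, ∗ b⟩` is perfect, so motions are the
functionals on `W^V` that kill one vector per bar: `b₀ r` at `root r`, or `b e` at one end of `e`
and `-b e` at the other. Rigidity says that these vectors span `W^V` (`isInfinitesimallyRigid_iff`).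

Let `B` be the span of the boundary vectors. Choosing bars means picking one vector from each of a
family of sets so that they span together with `B`; Rado's theorem
(`exists_transversal_sup_span_eq_top`) reduces this to a rank inequality for each edge set `F`. As
Plücker vectors span `W`, all candidate vectors of the edges in `F` together span at least the
kernel of the map `W^V → W^P` summing over the components `P` of `F`. Modulo that kernel `B` splits
over the parts, so the inequality for `F` follows from the partition condition for `P`. Conversely,
modulo the kernel of any partition only crossing edges and `B` contribute, which gives necessity. -/

namespace BodyBar

open Module Submodule

/-! ### Independent transversals -/

section Transversal

variable {K M ι : Type*} [Field K] [AddCommGroup M] [Module K M] [FiniteDimensional K M]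

/-- Rado's theorem on independent transversals, in its spanning form relative to a subspace `B`. -/
theorem exists_transversal_sup_span_eq_top (A : ι → Set M) (hA : ∀ i, (A i).Nonempty)
    (E : Finset ι) (B : Submodule K M)
    (h : ∀ F ⊆ E, finrank K M + F.card ≤
      E.card + finrank K ↥(B ⊔ ⨆ i ∈ F, span K (A i))) :
    ∃ x : ι → M, (∀ i, x i ∈ A i) ∧ B ⊔ span K (x '' E) = ⊤ := by
  classical
  induction E using Finset.induction_on generalizing B with
  | empty =>
    choose x hx using hA
    refine ⟨x, hx, ?_⟩
    have h0 := h ∅ subset_rfl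
    have hbot : ⨆ i ∈ (∅ : Finset ι), span K (A i) = ⊥ := by simp
    rw [hbot, sup_bot_eq, Finset.card_empty, add_zero, zero_add] at h0
    simp [eq_top_of_finrank_eq (le_antisymm (finrank_le B) h0)]
  | insert a E ha ih =>
    set U : Finset ι → Submodule K M := fun F => B ⊔ ⨆ i ∈ F, span K (A i) with hU
    have hmono : ∀ {F F' : Finset ι}, F ⊆ F' → U F ≤ U F' := fun hFF =>
      sup_le_sup_left (biSup_mono fun _ hi => hFF hi) _
    have hUunion : ∀ F F' : Finset ι, U (F ∪ F') = U F ⊔ U F' := fun F F' => by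
      simp only [hU]
      rw [Finset.iSup_union, sup_sup_distrib_left]
    have hcard : (insert a E).card = E.card + 1 := Finset.card_insert_of_notMem ha
    -- Tight sets leave no slack in the hypothesis for `insert a E`. Submodularity of dimension
    -- makes them closed under union.
    let tight : Finset ι → Prop := fun F =>
      F ⊆ E ∧ finrank K M + F.card = E.card + 1 + finrank K (U F)
    have hunion : ∀ F F', tight F → tight F' → tight (F ∪ F') := by
      rintro F F' ⟨hF, hF1⟩ ⟨hF', hF1'⟩
      refine ⟨Finset.union_subset hF hF', ?_⟩
      have h1 := h (F ∪ F') ((Finset.union_subset hF hF').trans (Finset.subset_insert _ _))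
      have h2 := h (F ∩ F') ((Finset.inter_subset_left.trans hF).trans (Finset.subset_insert _ _))
      rw [hcard] at h1 h2
      have h3 := finrank_sup_add_finrank_inf_eq (U F) (U F')
      have h4 : finrank K (U (F ∩ F')) ≤ finrank K ↥(U F ⊓ U F') :=
        finrank_mono (le_inf (hmono Finset.inter_subset_left) (hmono Finset.inter_subset_right))
      have h5 := Finset.card_union_add_card_inter F F'
      rw [← hUunion] at h3
      change _ ≤ _ + finrank K (U _) at h1 h2
      omega
    obtain ⟨y, hyA, hy⟩ : ∃ y ∈ A a, ∀ F, tight F → y ∉ U F := by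
      by_cases hne : ∃ F, tight F
      · have hfin : {F | tight F}.Finite :=
          E.powerset.finite_toSet.subset fun F hF => by simpa using hF.1
        obtain ⟨T, hT, hmax⟩ := hfin.exists_maximalFor Finset.card _ hne
        have hle : ∀ F, tight F → F ⊆ T := fun F hF => by
          have := hmax (hunion F T hF hT) (Finset.card_le_card Finset.subset_union_right)
          have := Finset.eq_of_subset_of_card_le (Finset.subset_union_right (s₁ := F)) this
          exact this ▸ Finset.subset_union_left
        -- Otherwise adding `a` to the largest tight set `T` would raise the cardinality but not the
        -- rank, against `h`.
        have hnot : ¬ A a ⊆ U T := fun hsub => by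
          have h1 := h (insert a T) (Finset.insert_subset_insert a hT.1)
          have h2 : U (insert a T) ≤ U T := by
            simp only [hU, Finset.iSup_insert]
            exact sup_le le_sup_left (sup_le (span_le.2 hsub) le_sup_right)
          have h3 : finrank K (U (insert a T)) ≤ finrank K (U T) := finrank_mono h2
          have h4 := hT.2
          rw [hcard, Finset.card_insert_of_notMem fun haT => ha (hT.1 haT)] at h1
          change _ ≤ _ + finrank K (U _) at h1
          omega
        obtain ⟨y, hyA, hy⟩ := Set.not_subset.1 hnot
        exact ⟨y, hyA, fun F hF hyF => hy (hmono (hle F hF) hyF)⟩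
      · obtain ⟨y, hy⟩ := hA a
        exact ⟨y, hy, fun F hF => (hne ⟨F, hF⟩).elim⟩
    -- Dropping `a` costs one unit on the right: a tight `F` regains it because `y` raises the rank,
    -- any other `F` had slack.
    obtain ⟨x, hxA, hx⟩ := ih (B ⊔ span K {y}) fun F hF => by
      have h1 := h F (hF.trans (Finset.subset_insert _ _))
      change _ ≤ _ + finrank K (U F) at h1
      have hle : U F ≤ B ⊔ span K {y} ⊔ ⨆ i ∈ F, span K (A i) :=
        sup_le_sup_right le_sup_left _
      rw [hcard] at h1
      by_cases hF' : tight F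
      · have hlt : U F < B ⊔ span K {y} ⊔ ⨆ i ∈ F, span K (A i) := by
          refine lt_of_le_of_ne hle fun heq => hy F hF' ?_
          rw [heq]
          exact mem_sup_left (mem_sup_right (mem_span_singleton_self y))
        have := finrank_lt_finrank_of_lt hlt
        omega
      · have h2 : finrank K M + F.card ≠ E.card + 1 + finrank K (U F) := fun h => hF' ⟨hF, h⟩
        have := finrank_mono hle
        omega
    refine ⟨Function.update x a y, fun i => ?_, ?_⟩
    · rcases eq_or_ne i a with rfl | hi
      · simpa using hyA
      · simpa [hi] using hxA i
    · have himg : Function.update x a y '' (insert a E : Finset ι) = insert y (x '' E) := by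
        rw [Finset.coe_insert, Set.image_insert_eq, Function.update_self]
        congr 1
        refine Set.image_congr fun i hi => Function.update_of_ne ?_ _ _
        rintro rfl
        exact ha hi
      rw [himg, span_insert, ← sup_assoc, hx]

end Transversal

/-! ### Rank counts over partitions -/

section Ranks

variable {K W V P E R : Type*} [Field K] [AddCommGroup W] [Module K W]

theorem finrank_sup_ker_add {M N : Type*} [AddCommGroup M] [Module K M] [FiniteDimensional K M]
    [AddCommGroup N] [Module K N] (q : M →ₗ[K] N) (hq : Function.Surjective q)
    (B : Submodule K M) :
    finrank K ↥(B ⊔ LinearMap.ker q) + finrank K N = finrank K M + finrank K (B.map q) := by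
  have h0 : (LinearMap.ker q).map q = ⊥ := le_bot_iff.1 (Submodule.map_le_iff_le_comap.2 le_rfl)
  have h1 := LinearMap.finrank_range_add_finrank_ker (q.domRestrict (B ⊔ LinearMap.ker q))
  have h2 := LinearMap.finrank_range_add_finrank_ker q
  rw [LinearMap.range_eq_top.2 hq, finrank_top] at h2
  rw [LinearMap.range_domRestrict, Submodule.map_sup, h0, sup_bot_eq,
    LinearMap.ker_domRestrict, ← LinearEquiv.finrank_eq
      (Submodule.comapSubtypeEquivOfLe (le_sup_right : LinearMap.ker q ≤ B ⊔ _)).symm] at h1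
  omega

variable [Fintype V] [DecidableEq V] [DecidableEq P]

variable (K W) in
/-- The linear map `W ^ V → W ^ P` that sums the coordinates over each fibre of `p : V → P`. -/
noncomputable def fibreSum (p : V → P) : (V → W) →ₗ[K] (P → W) :=
  LinearMap.lsum K (fun _ => W) K fun v => LinearMap.single K (fun _ => W) (p v)

@[simp]
theorem fibreSum_single (p : V → P) (v : V) (w : W) :
    fibreSum K W p (Pi.single v w) = Pi.single (p v) w := by
  rw [fibreSum, LinearMap.lsum_piSingle, LinearMap.single_apply]

variable [Fintype P]

theorem fibreSum_comp_fibreSum {p : V → P} {g : P → V} (hg : Function.RightInverse g p) :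
    fibreSum K W p ∘ₗ fibreSum K W g = LinearMap.id := by
  refine LinearMap.pi_ext fun x w => ?_
  simp [hg x]

theorem fibreSum_surjective {p : V → P} (hp : Function.Surjective p) :
    Function.Surjective (fibreSum K W p) := fun y =>
  ⟨fibreSum K W (Function.surjInv hp) y,
    LinearMap.congr_fun (fibreSum_comp_fibreSum (Function.rightInverse_surjInv hp)) y⟩

/-- Modulo `U`, each coordinate can be moved to a chosen representative of its fibre, so a vector is
determined by its fibre sums. -/
theorem ker_fibreSum_le {p : V → P} (hp : Function.Surjective p) (U : Submodule K (V → W))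
    (hU : ∀ u v, p u = p v → ∀ w : W, Pi.single u w - Pi.single v w ∈ U) :
    LinearMap.ker (fibreSum K W p) ≤ U := by
  intro y hy
  set g := Function.surjInv hp
  have key : U.mkQ ∘ₗ (LinearMap.id - fibreSum K W g ∘ₗ fibreSum K W p) = 0 := by
    refine LinearMap.pi_ext fun v w => ?_
    have := hU v (g (p v)) (Function.surjInv_eq hp (p v)).symm w
    rw [← Submodule.Quotient.mk_eq_zero] at this
    simpa using this
  have := LinearMap.congr_fun key y
  simpa [LinearMap.mem_ker.1 hy] using this

theorem finrank_span_single [FiniteDimensional K W] (f : R → P) (S : R → W) :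
    finrank K (span K (Set.range fun r => (Pi.single (f r) (S r) : P → W))) =
      ∑ x, finrank K (span K (S '' {r | f r = x})) := by
  set T : P → Submodule K W := fun x => span K (S '' {r | f r = x}) with hT
  let Φ : ((x : P) → T x) →ₗ[K] (P → W) :=
    LinearMap.pi fun x => (T x).subtype ∘ₗ LinearMap.proj x
  have hΦ : Function.Injective Φ := fun y z h => funext fun x => Subtype.ext (congrFun h x)
  have hrange : span K (Set.range fun r => (Pi.single (f r) (S r) : P → W)) =
      LinearMap.range Φ := by
    refine le_antisymm (span_le.2 ?_) ?_
    · rintro _ ⟨r, rfl⟩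
      refine ⟨Pi.single (f r) ⟨S r, subset_span ⟨r, rfl, rfl⟩⟩, funext fun x => ?_⟩
      rcases eq_or_ne x (f r) with rfl | hx
      · simp [Φ]
      · simp [Φ, hx]
    · rintro _ ⟨y, rfl⟩
      have hle : ∀ x, T x ≤ (span K (Set.range fun r => (Pi.single (f r) (S r) : P → W))).comap
          (LinearMap.single K (fun _ => W) x) := fun x => by
        rw [hT, span_le]
        rintro _ ⟨r, rfl, rfl⟩
        exact subset_span ⟨r, rfl⟩
      rw [← Finset.univ_sum_single (Φ y)]
      exact Submodule.sum_mem _ fun x _ => hle x (y x).2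
  rw [hrange, LinearMap.finrank_range_of_inj hΦ, finrank_pi_fintype]

theorem finrank_sup_ker_fibreSum [FiniteDimensional K W] {p : V → P} (hp : Function.Surjective p)
    (root : R → V) (S : R → W) :
    finrank K ↥(span K (Set.range fun r => (Pi.single (root r) (S r) : V → W)) ⊔
        LinearMap.ker (fibreSum K W p)) + Fintype.card P * finrank K W =
      finrank K (V → W) + ∑ x, finrank K (span K (S '' {r | p (root r) = x})) := by
  have h := finrank_sup_ker_add (fibreSum K W p) (fibreSum_surjective hp)
    (span K (Set.range fun r => (Pi.single (root r) (S r) : V → W)))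
  have hcomp : (fibreSum K W p ∘ fun r => (Pi.single (root r) (S r) : V → W)) =
      fun r => Pi.single (p (root r)) (S r) := funext fun r => fibreSum_single p (root r) (S r)
  rwa [Submodule.map_span, ← Set.range_comp, hcomp, finrank_span_single (fun r => p (root r)) S,
    finrank_pi_fintype K (M := fun _ : P => W), Finset.sum_const, Finset.card_univ,
    smul_eq_mul] at h

theorem exists_sup_span_eq_top_iff [FiniteDimensional K W] [Fintype E] (s t : E → V) (C : Set W)
    (hne : C.Nonempty) (hC : span K C = ⊤) (root : R → V) (S : R → W) :
    (∃ c : E → W, (∀ e, c e ∈ C) ∧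
      span K (Set.range fun r => (Pi.single (root r) (S r) : V → W)) ⊔
        span K (Set.range fun e => (Pi.single (s e) (c e) - Pi.single (t e) (c e) : V → W)) = ⊤) ↔
    ∀ σ : Setoid V, Nat.card (Quotient σ) * finrank K W ≤
      Nat.card {e // ¬ σ (s e) (t e)} +
        ∑ᶠ x : Quotient σ, finrank K (span K (S '' {r | (⟦root r⟧ : Quotient σ) = x})) := by
  classical
  set B := span K (Set.range fun r => (Pi.single (root r) (S r) : V → W))
  constructor
  · rintro ⟨c, -, hc⟩ σ
    have hle : (⊤ : Submodule K (V → W)) ≤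
        (B ⊔ LinearMap.ker (fibreSum K W (Quotient.mk σ))) ⊔
          span K (Set.range fun e : {e // ¬ σ (s e) (t e)} =>
            (Pi.single (s e) (c e) - Pi.single (t e) (c e) : V → W)) := by
      rw [← hc]
      refine sup_le (le_sup_of_le_left le_sup_left) (span_le.2 ?_)
      rintro _ ⟨e, rfl⟩
      by_cases he : σ (s e) (t e)
      · refine mem_sup_left (mem_sup_right ?_)
        have : (⟦s e⟧ : Quotient σ) = ⟦t e⟧ := Quotient.sound he
        simp [this]
      · exact mem_sup_right (subset_span ⟨⟨e, he⟩, rfl⟩)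
    have h1 := finrank_mono hle
    have h2 := finrank_sup_ker_fibreSum (K := K) (p := Quotient.mk σ) Quotient.mk_surjective root S
    change finrank K ↥(B ⊔ _) + _ = _ at h2
    have h3 := finrank_add_le_finrank_add_finrank
      (B ⊔ LinearMap.ker (fibreSum K W (Quotient.mk σ)))
      (span K (Set.range fun e : {e // ¬ σ (s e) (t e)} =>
            (Pi.single (s e) (c e) - Pi.single (t e) (c e) : V → W)))
    have h4 := finrank_range_le_card (R := K) fun e : {e // ¬ σ (s e) (t e)} =>
            (Pi.single (s e) (c e) - Pi.single (t e) (c e) : V → W)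
    rw [Set.finrank] at h4
    rw [finrank_top] at h1
    rw [finsum_eq_sum_of_fintype, Nat.card_eq_fintype_card, Nat.card_eq_fintype_card]
    omega
  · intro h
    let bars : E → Set (V → W) := fun e =>
      (fun c => (Pi.single (s e) c - Pi.single (t e) c : V → W)) '' C
    have hbars : ∀ e c, (Pi.single (s e) c - Pi.single (t e) c : V → W) ∈ span K (bars e) := by
      intro e c
      have : (⊤ : Submodule K W) ≤ (span K (bars e)).comap
          (LinearMap.single K (fun _ => W) (s e) - LinearMap.single K (fun _ => W) (t e)) := by
        rw [← hC, span_le]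
        exact fun c hc => subset_span ⟨c, hc, rfl⟩
      exact this (mem_top (x := c))
    obtain ⟨x, hx, hxtop⟩ := exists_transversal_sup_span_eq_top bars (fun e => hne.image _)
      Finset.univ B fun F _ => by
        -- The classes are the connected components of `(V, F)`.
        let σ : Setoid V := Relation.EqvGen.setoid fun u v => ∃ e ∈ F, s e = u ∧ t e = v
        have hσ : ∀ u v, σ u v → ∀ w,
            (Pi.single u w - Pi.single v w : V → W) ∈ ⨆ e ∈ F, span K (bars e) := by
          intro u v huv w
          induction huv with
          | rel u v huv =>
            obtain ⟨e, he, rfl, rfl⟩ := huv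
            exact mem_iSup_of_mem e (mem_iSup_of_mem he (hbars e w))
          | refl u => simp
          | symm u v _ ih => simpa using neg_mem ih
          | trans u v z _ _ ih₁ ih₂ => simpa using add_mem ih₁ ih₂
        have hker : LinearMap.ker (fibreSum K W (Quotient.mk σ)) ≤ ⨆ e ∈ F, span K (bars e) :=
          ker_fibreSum_le Quotient.mk_surjective _ fun u v huv => hσ u v (Quotient.exact huv)
        have h1 := finrank_mono (sup_le_sup_left hker B)
        have h2 := finrank_sup_ker_fibreSum (K := K) (p := Quotient.mk σ)
          Quotient.mk_surjective root S
        change finrank K ↥(B ⊔ _) + _ = _ at h2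
        have h3 := h σ
        rw [finsum_eq_sum_of_fintype, Nat.card_eq_fintype_card, Nat.card_eq_fintype_card] at h3
        -- Crossing edges lie outside `F`; an edge outside `F` may still join vertices of one
        -- component.
        have h4 : Fintype.card {e // ¬ σ (s e) (t e)} ≤ (Finset.univ \ F).card := by
          rw [Fintype.card_subtype]
          refine Finset.card_le_card fun e he => ?_
          simp only [Finset.mem_filter_univ, Finset.mem_sdiff, Finset.mem_univ, true_and] at he ⊢
          exact fun heF => he (Relation.EqvGen.rel _ _ ⟨e, heF, rfl, rfl⟩)
        have h5 := Finset.card_sdiff_add_card_eq_card (Finset.subset_univ F)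
        omega
    choose c hc hcx using hx
    refine ⟨c, hc, ?_⟩
    rw [Finset.coe_univ, Set.image_univ] at hxtop
    rw [← hxtop]
    congr 3
    exact funext hcx

end Ranks

/-! ### The Hodge pairing and Plücker vectors -/

section Pairing

variable {n k l : ℕ}

theorem pairing_stdBasis (h : k + l = n) (a : ExtPow n l) (I : Set.powersetCard (Fin n) k) :
    pairing h a (stdBasis n k I) = shuffleSign (I : Finset (Fin n)) *
      (stdBasis n l).repr a (Set.powersetCard.compl (by simpa [add_comm] using h) I) := by
  classical
  simp only [pairing, innerProd, hodgeStar, Basis.constr_basis, map_smul, Basis.repr_self,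
    Finsupp.smul_apply, Finsupp.single_apply, smul_eq_mul, mul_ite, mul_one, mul_zero,
    Finset.sum_ite_eq, Finset.mem_univ, if_true]
  rw [mul_comm]

/-- The bilinear pairing `⟨a, ∗ b⟩` as a linear map into the dual space. -/
noncomputable def pairingMap (h : k + l = n) : ExtPow n l →ₗ[ℝ] Dual ℝ (ExtPow n k) :=
  LinearMap.mk₂ ℝ (pairing h)
    (fun a a' b => by
      simp only [pairing, innerProd, map_add, Finsupp.add_apply, add_mul, Finset.sum_add_distrib])
    (fun c a b => by
      simp only [pairing, innerProd, map_smul, Finsupp.smul_apply, smul_eq_mul, mul_assoc,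
        Finset.mul_sum])
    (fun a b b' => by
      simp only [pairing, innerProd, map_add, Finsupp.add_apply, mul_add, Finset.sum_add_distrib])
    (fun c a b => by
      simp only [pairing, innerProd, map_smul, Finsupp.smul_apply, smul_eq_mul, Finset.mul_sum]
      exact Finset.sum_congr rfl fun _ _ => mul_left_comm _ _ _)

@[simp]
theorem pairingMap_apply (h : k + l = n) (a : ExtPow n l) (b : ExtPow n k) :
    pairingMap h a b = pairing h a b := rfl

theorem pairingMap_injective (h : k + l = n) : Function.Injective (pairingMap h) := by
  rw [injective_iff_map_eq_zero]
  intro a ha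
  refine (stdBasis n l).repr.map_eq_zero_iff.1 (Finsupp.ext fun J => ?_)
  have hJ := LinearMap.congr_fun ha (stdBasis n k
    ((Set.powersetCard.compl (by simpa [add_comm] using h)).symm J))
  rw [pairingMap_apply, pairing_stdBasis, Equiv.apply_symm_apply] at hJ
  exact (mul_eq_zero.1 hJ).resolve_left (pow_ne_zero _ (by norm_num))

theorem finrank_extPow : finrank ℝ (ExtPow n k) = n.choose k := by
  rw [exteriorPower.finrank_eq, finrank_fin_fun]

theorem pairingMap_surjective (h : k + l = n) : Function.Surjective (pairingMap h) := by
  refine (LinearMap.injective_iff_surjective_of_finrank_eq_finrank ?_).1 (pairingMap_injective h)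
  rw [Subspace.dual_finrank_eq, finrank_extPow, finrank_extPow, Nat.choose_symm_of_eq_add]
  omega

/-- Each standard basis vector is a pure wedge, hence a nonzero multiple of the chosen
representative of its class. -/
theorem span_range_coords : span ℝ (Set.range (coords : Gr k n → ExtPow n k)) = ⊤ := by
  rw [eq_top_iff, ← (stdBasis n k).span_eq, span_le]
  rintro _ ⟨I, rfl⟩
  set v : Fin k → Fin n → ℝ := fun i =>
    Pi.basisFun ℝ (Fin n) (Set.powersetCard.ofFinEmbEquiv.symm I i)
  have hv : LinearIndependent ℝ v :=
    (Pi.basisFun ℝ (Fin n)).linearIndependent.comp _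
      (Set.powersetCard.ofFinEmbEquiv.symm I).injective
  have hI : stdBasis n k I = exteriorPower.ιMulti ℝ k v := exteriorPower.basis_apply ..
  have h0 : exteriorPower.ιMulti ℝ k v ≠ 0 := hI ▸ (stdBasis n k).ne_zero I
  obtain ⟨a, ha⟩ := Projectivization.exists_smul_eq_mk_rep ℝ _ h0
  have hmem : a • exteriorPower.ιMulti ℝ k v ∈
      span ℝ (Set.range (coords : Gr k n → ExtPow n k)) :=
    subset_span ⟨⟨_, v, hv, h0, rfl⟩, ha.symm⟩
  rw [hI]
  exact (Submodule.smul_mem_iff' _ a).1 hmem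

theorem gr_nonempty (h : k ≤ n) : Nonempty (Gr k n) := by
  by_contra hempty
  rw [not_nonempty_iff] at hempty
  have hspan := span_range_coords (k := k) (n := n)
  rw [Set.range_eq_empty, span_empty] at hspan
  have := finrank_top ℝ (ExtPow n k)
  rw [← hspan, finrank_bot, finrank_extPow] at this
  exact (Nat.choose_pos h).ne this

end Pairing

/-! ### Rigidity as spanning; partitions as equivalence relations -/

section Frameworks

variable {α β R : Type*}

theorem isInfinitesimallyRigid_iff {d : ℕ} (hd : 1 ≤ d) (G : Graph α β) [Fintype G.vertexSet]
    [DecidableEq G.vertexSet] (s t : G.edgeSet → G.vertexSet)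
    (hst : ∀ e : G.edgeSet, G.IsLink e (s e) (t e)) (root : R → G.vertexSet)
    (b : G.edgeSet → Gr 2 (d + 1)) (b₀ : R → Gr 2 (d + 1)) :
    IsInfinitesimallyRigid hd G root b b₀ ↔
      span ℝ (Set.range fun r =>
          (Pi.single (root r) (coords (b₀ r)) : G.vertexSet → ExtPow (d + 1) 2)) ⊔
        span ℝ (Set.range fun e => (Pi.single (s e) (coords (b e)) -
          Pi.single (t e) (coords (b e)) : G.vertexSet → ExtPow (d + 1) 2)) = ⊤ := by
  have hn : 2 + (d - 1) = d + 1 := by omega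
  set U := span ℝ (Set.range fun r =>
      (Pi.single (root r) (coords (b₀ r)) : G.vertexSet → ExtPow (d + 1) 2)) ⊔
    span ℝ (Set.range fun e => (Pi.single (s e) (coords (b e)) -
      Pi.single (t e) (coords (b e)) : G.vertexSet → ExtPow (d + 1) 2)) with hU
  -- Here `φ` is the functional on `W^V` that `m` represents through the pairing.
  have key : ∀ (m : G.vertexSet → ExtPow (d + 1) (d - 1))
      (φ : Dual ℝ (G.vertexSet → ExtPow (d + 1) 2)),
      (∀ v w, φ (Pi.single v w) = pairingMap hn (m v) w) →
      (IsInfinitesimalMotion hd G root b b₀ m ↔ U ≤ LinearMap.ker φ) := by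
    intro m φ hφ
    have hsub : ∀ u v w, pairing hn (m u - m v) w = φ (Pi.single u w - Pi.single v w) := by
      intro u v w
      rw [map_sub, hφ, hφ, ← pairingMap_apply, map_sub, LinearMap.sub_apply]
    rw [hU, sup_le_iff, span_le, span_le, Set.range_subset_iff, Set.range_subset_iff, and_comm]
    refine and_congr ⟨fun h e => ?_, fun h e u v huv => ?_⟩ (forall_congr' fun r => ?_)
    · rw [SetLike.mem_coe, LinearMap.mem_ker, ← hsub]
      exact h e _ _ (hst e)
    · have he := h e
      rw [SetLike.mem_coe, LinearMap.mem_ker] at he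
      rw [hsub]
      -- Reversing the orientation of `e` only changes a sign.
      rcases huv.eq_and_eq_or_eq_and_eq (hst e) with ⟨hu, hv⟩ | ⟨hu, hv⟩
      · rw [Subtype.ext hu, Subtype.ext hv, he]
      · rw [Subtype.ext hu, Subtype.ext hv, ← neg_sub, map_neg, he, neg_zero]
    · rw [SetLike.mem_coe, LinearMap.mem_ker, hφ, pairingMap_apply]
  constructor
  · intro hrig
    by_contra hne
    obtain ⟨φ, hφ0, hφ⟩ := U.exists_le_ker_of_lt_top (lt_top_iff_ne_top.2 hne)
    choose m hm using fun v => pairingMap_surjective hn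
      (φ ∘ₗ LinearMap.single ℝ (fun _ => ExtPow (d + 1) 2) v)
    have hm' : ∀ v w, φ (Pi.single v w) = pairingMap hn (m v) w := fun v w => by
      rw [hm]
      rfl
    have hm0 := hrig m ((key m φ hm').2 hφ)
    refine hφ0 (LinearMap.pi_ext fun v w => ?_)
    rw [hm', hm0, Pi.zero_apply, map_zero]
    rfl
  · intro htop m hm
    set φ := LinearMap.lsum ℝ (fun _ => ExtPow (d + 1) 2) ℝ fun v => pairingMap hn (m v)
    have hφ : ∀ v w, φ (Pi.single v w) = pairingMap hn (m v) w := fun v w =>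
      LinearMap.lsum_piSingle ..
    have hker := (key m φ hφ).1 hm
    rw [htop] at hker
    refine funext fun v => pairingMap_injective hn (LinearMap.ext fun w => ?_)
    rw [← hφ, Pi.zero_apply, map_zero]
    exact hker mem_top

variable {V : Set α}

/-- The subset of `V` that corresponds to an equivalence class. -/
def block (σ : Setoid V) (x : Quotient σ) : Set α := Subtype.val '' {v : V | ⟦v⟧ = x}

theorem mem_block {σ : Setoid V} {x : Quotient σ} (v : V) : (v : α) ∈ block σ x ↔ ⟦v⟧ = x :=
  Subtype.val_injective.mem_set_image

theorem block_injective (σ : Setoid V) : Function.Injective (block σ) := by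
  intro x y hxy
  obtain ⟨v, rfl⟩ := Quotient.exists_rep x
  rw [← mem_block, ← hxy, mem_block]

theorem exists_finpartition_of_setoid [Finite V] (σ : Setoid V) :
    ∃ P : Finpartition V, (P.parts : Set (Set α)) = Set.range (block σ) := by
  classical
  have := Fintype.ofFinite (Quotient σ)
  refine ⟨⟨Finset.univ.image (block σ), ?_, ?_, ?_⟩, by simp⟩
  · rw [Finset.supIndep_iff_pairwiseDisjoint]
    intro X hX Y hY hne
    simp only [Finset.coe_image, Finset.coe_univ, Set.image_univ] at hX hY
    obtain ⟨x, rfl⟩ := hX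
    obtain ⟨y, rfl⟩ := hY
    refine Set.disjoint_left.2 ?_
    rintro _ ⟨v, rfl, rfl⟩ hv
    rw [id, mem_block] at hv
    exact hne (by rw [hv])
  · rw [Finset.sup_id_set_eq_sUnion]
    ext a
    simp only [Finset.coe_image, Finset.coe_univ, Set.image_univ, Set.sUnion_range, Set.mem_iUnion]
    constructor
    · rintro ⟨_, v, -, rfl⟩
      exact v.2
    · exact fun ha => ⟨⟦⟨a, ha⟩⟧, (mem_block ⟨a, ha⟩).2 rfl⟩
  · simp only [Finset.mem_image, Finset.mem_univ, true_and, not_exists]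
    intro x hx
    obtain ⟨v, rfl⟩ := Quotient.exists_rep x
    have hv := (mem_block (σ := σ) v).2 rfl
    rw [hx] at hv
    exact hv

theorem exists_setoid_of_finpartition (P : Finpartition V) :
    ∃ σ : Setoid V, (P.parts : Set (Set α)) = Set.range (block σ) := by
  have hcover : ∀ v : V, ∃ X ∈ P.parts, (v : α) ∈ X := fun v => by
    have hv : (v : α) ∈ P.parts.sup id := by
      rw [P.sup_parts]
      exact v.2
    rwa [Finset.sup_id_set_eq_sUnion] at hv
  choose p hp hmem using hcover
  have huniq : ∀ (v : V), ∀ X ∈ P.parts, (v : α) ∈ X → X = p v := fun v X hX hv => by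
    by_contra hne
    exact Set.disjoint_left.1 (P.disjoint hX (hp v) hne) hv (hmem v)
  have hsub : ∀ X ∈ P.parts, X ⊆ V := fun X hX => P.le hX
  have hblock : ∀ v : V, block (Setoid.ker p) ⟦v⟧ = p v := fun v => by
    ext a
    constructor
    · rintro ⟨u, hu, rfl⟩
      have hu : p u = p v := Quotient.exact hu
      exact hu ▸ hmem u
    · intro ha
      refine ⟨⟨a, hsub _ (hp v) ha⟩, Quotient.sound ?_, rfl⟩
      exact (huniq ⟨a, _⟩ _ (hp v) ha).symm
  refine ⟨Setoid.ker p, Set.Subset.antisymm (fun X hX => ?_) ?_⟩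
  · obtain ⟨a, ha⟩ := Set.nonempty_iff_ne_empty.2 (P.ne_bot hX)
    exact ⟨⟦⟨a, hsub X hX ha⟩⟧, (hblock _).trans (huniq ⟨a, _⟩ X hX ha).symm⟩
  · rintro _ ⟨x, rfl⟩
    obtain ⟨v, rfl⟩ := Quotient.exists_rep x
    rw [hblock]
    exact hp v

theorem card_parts_eq {P : Finpartition V} {σ : Setoid V}
    (h : (P.parts : Set (Set α)) = Set.range (block σ)) :
    P.parts.card = Nat.card (Quotient σ) := by
  rw [← Set.ncard_coe_finset, h, ← Nat.card_coe_set_eq,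
    Nat.card_range_of_injective (block_injective σ)]

theorem ncard_crossingEdges {G : Graph α β} {s t : G.edgeSet → G.vertexSet}
    (hst : ∀ e : G.edgeSet, G.IsLink e (s e) (t e)) {P : Finpartition G.vertexSet}
    {σ : Setoid G.vertexSet} (h : (P.parts : Set (Set α)) = Set.range (block σ)) :
    (crossingEdges G P).ncard = Nat.card {e // ¬ σ (s e) (t e)} := by
  have hmem : ∀ X, X ∈ P.parts ↔ ∃ x, block σ x = X := fun X => by
    rw [← Finset.mem_coe, h, Set.mem_range]
  have hcross : crossingEdges G P = Subtype.val '' {e | ¬ σ (s e) (t e)} := by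
    ext e
    constructor
    · rintro ⟨X, hX, Y, hY, hne, x, hx, y, hy, hxy⟩
      obtain ⟨X, rfl⟩ := (hmem X).1 hX
      obtain ⟨Y, rfl⟩ := (hmem Y).1 hY
      obtain ⟨u, rfl, rfl⟩ := hx
      obtain ⟨v, rfl, rfl⟩ := hy
      refine ⟨⟨e, hxy.edge_mem⟩, fun hσ => hne ?_, rfl⟩
      rcases hxy.eq_and_eq_or_eq_and_eq (hst ⟨e, hxy.edge_mem⟩) with ⟨hu, hv⟩ | ⟨hu, hv⟩
      · exact congrArg (block σ) ((congrArg _ (Subtype.ext hu)).trans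
          ((Quotient.sound hσ).trans (congrArg _ (Subtype.ext hv.symm))))
      · exact congrArg (block σ) ((congrArg _ (Subtype.ext hu)).trans
          ((Quotient.sound (σ.symm hσ)).trans (congrArg _ (Subtype.ext hv.symm))))
    · rintro ⟨e, he, rfl⟩
      refine ⟨_, (hmem _).2 ⟨⟦s e⟧, rfl⟩, _, (hmem _).2 ⟨⟦t e⟧, rfl⟩,
        fun heq => he (Quotient.exact (block_injective σ heq)), s e, (mem_block _).2 rfl,
        t e, (mem_block _).2 rfl, hst e⟩
  rw [hcross, Set.ncard_image_of_injective _ Subtype.val_injective]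
  rfl

theorem sum_boundaryDim {d : ℕ} {G : Graph α β} (root : R → G.vertexSet)
    (b₀ : R → Gr 2 (d + 1)) {P : Finpartition G.vertexSet}
    {σ : Setoid G.vertexSet} (h : (P.parts : Set (Set α)) = Set.range (block σ)) :
    ∑ X ∈ P.parts, boundaryDim G root b₀ X =
      ∑ᶠ x : Quotient σ, finrank ℝ
        (span ℝ ((fun r => coords (b₀ r)) '' {r | (⟦root r⟧ : Quotient σ) = x})) := by
  rw [← finsum_mem_coe_finset, h, finsum_mem_range (block_injective σ)]
  refine finsum_congr fun x => ?_
  have hx : {r | (root r : α) ∈ block σ x} = {r | ⟦root r⟧ = x} :=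
    Set.ext fun r => mem_block (root r)
  rw [boundaryDim, hx]

end Frameworks

end BodyBar

theorem mainTheorem6 {α β R : Type*} [Finite R] (G : Graph α β)
    (hV : G.vertexSet.Finite) (hE : G.edgeSet.Finite) (d : ℕ) (hd : 1 ≤ d)
    (root : R → G.vertexSet) (b₀ : R → BodyBar.Gr 2 (d + 1)) :
    (∃ b : G.edgeSet → BodyBar.Gr 2 (d + 1),
        BodyBar.IsInfinitesimallyRigid hd G root b b₀) ↔
      ∀ P : Finpartition G.vertexSet,
        ((BodyBar.crossingEdges G P).ncard : ℤ) ≥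
          ((d + 1).choose 2 : ℤ) * (P.parts.card : ℤ) -
            ∑ X ∈ P.parts, (BodyBar.boundaryDim G root b₀ X : ℤ) := by
  classical
  have := hV.fintype
  have := hE.fintype
  have hends : ∀ e : G.edgeSet, ∃ p : G.vertexSet × G.vertexSet, G.IsLink e p.1 p.2 := fun e => by
    obtain ⟨x, y, hxy⟩ := G.exists_isLink_of_mem_edgeSet e.2
    exact ⟨(⟨x, hxy.left_mem⟩, ⟨y, hxy.right_mem⟩), hxy⟩
  choose p hp using hends
  have hspan := BodyBar.exists_sup_span_eq_top_iff (fun e => (p e).1) (fun e => (p e).2)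
    (Set.range (BodyBar.coords : BodyBar.Gr 2 (d + 1) → _))
    (Set.range_nonempty_iff_nonempty.2 (BodyBar.gr_nonempty (by omega)))
    BodyBar.span_range_coords root (fun r => BodyBar.coords (b₀ r))
  rw [BodyBar.finrank_extPow] at hspan
  -- Moving the subtracted sum across turns the integer inequality into one over `ℕ`.
  have hcount : ∀ (P : Finpartition G.vertexSet) (σ : Setoid G.vertexSet),
      (P.parts : Set (Set α)) = Set.range (BodyBar.block σ) →
      (((BodyBar.crossingEdges G P).ncard : ℤ) ≥ ((d + 1).choose 2 : ℤ) * (P.parts.card : ℤ) -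
          ∑ X ∈ P.parts, (BodyBar.boundaryDim G root b₀ X : ℤ) ↔
        Nat.card (Quotient σ) * (d + 1).choose 2 ≤ Nat.card {e // ¬ σ (p e).1 (p e).2} +
          ∑ᶠ x : Quotient σ, Module.finrank ℝ (Submodule.span ℝ
            ((fun r => BodyBar.coords (b₀ r)) '' {r | (⟦root r⟧ : Quotient σ) = x}))) := by
    intro P σ h
    rw [← BodyBar.card_parts_eq h, ← BodyBar.ncard_crossingEdges hp h,
      ← BodyBar.sum_boundaryDim root b₀ h, ge_iff_le, sub_le_iff_le_add, mul_comm]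
    norm_cast
  refine Iff.trans (Iff.trans ⟨?_, ?_⟩ hspan) ⟨?_, ?_⟩
  · rintro ⟨b, hb⟩
    exact ⟨fun e => BodyBar.coords (b e), fun e => ⟨b e, rfl⟩,
      (BodyBar.isInfinitesimallyRigid_iff hd G _ _ hp root b b₀).1 hb⟩
  · rintro ⟨c, hc, htop⟩
    choose b hb using hc
    obtain rfl : (fun e => BodyBar.coords (b e)) = c := funext hb
    exact ⟨b, (BodyBar.isInfinitesimallyRigid_iff hd G _ _ hp root b b₀).2 htop⟩
  · intro h P
    obtain ⟨σ, hσ⟩ := BodyBar.exists_setoid_of_finpartition P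
    exact (hcount P σ hσ).2 (h σ)
  · intro h σ
    obtain ⟨P, hP⟩ := BodyBar.exists_finpartition_of_setoid σ
    exact (hcount P σ hP).1 (h P)
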